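/- Let $\Gamma$ be a finite simplicial graph with vertex set $V(\Gamma)$ such that $|V(\Gamma)|\ge 4$ and both $\Gamma$ and its complement graph $\bar\Gamma$ are connected. Let $$A(\Gamma)=\langle\, v\in V(\Gamma)\mid vw=wv \text{ whenever } \{v,w\} \text{ is an edge of } \Gamma\,\rangle$$ be the right-angled Artin group of $\Gamma$. Let $\Gamma^e$ be its extension graph: the vertices are the elements $v^g=g^{-1}vg$ of $A(\Gamma)$ with $v\in V(\Gamma)$ and $g\in A(\Gamma)$, and two distinct vertices are adjacent if and only if they commute in $A(\Gamma)$. Let $d$ be the graph metric of $\Gamma^e$, and let $A(\Gamma)$ act on $\Gamma^e$ from the right by conjugation, $v^h\cdot g=v^{hg}$. Then $\Gamma^e$ is connected, and for every $g\in A(\Gamma)$ the asymptotic translation length $$\tau(g)=\lim_{n\to\infty}\frac{d(x\cdot g^n,x)}{n}$$ exists and does not depend on the vertex $x$ of $\Gamma^e$. Some $g\in A(\Gamma)$ has $\tau(g)>0$, and the minimal asymptotic translation length $$\mathcal L_{(\Gamma^e,d)}(A(\Gamma))=\inf\{\tau(g): g\in A(\Gamma),\ \tau(g)>0\}$$ satisfies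 $$\mathcal L_{(\Gamma^e,d)}(A(\Gamma))\ \ge\ \frac{1}{|V(\Gamma)|-2}.$$ -/

import Mathlib

open scoped RightActions Topology

namespace ExtensionGraph

/-- Defining relators of the right-angled Artin group: commutators of adjacent vertices. -/
def raagRels {V : Type*} (Γ : SimpleGraph V) : Set (FreeGroup V) :=
  {r | ∃ v w : V, Γ.Adj v w ∧ r =
    FreeGroup.of v * FreeGroup.of w * (FreeGroup.of v)⁻¹ * (FreeGroup.of w)⁻¹}

/-- The right-angled Artin group `A(Γ)`. -/
abbrev RAAG {V : Type*} (Γ : SimpleGraph V) : Type _ := PresentedGroup (raagRels Γ)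

/-- The generator of `A(Γ)` given by a vertex of `Γ`. -/
def RAAG.gen {V : Type*} (Γ : SimpleGraph V) (v : V) : RAAG Γ := PresentedGroup.of v

/-- Vertices of the extension graph: the elements `v^g = g⁻¹ v g` of `A(Γ)`. -/
def ExtVertex {V : Type*} (Γ : SimpleGraph V) : Type _ :=
  {a : RAAG Γ // ∃ (v : V) (g : RAAG Γ), a = g⁻¹ * RAAG.gen Γ v * g}

/-- The extension graph `Γ^e`: distinct vertices are adjacent iff they commute in `A(Γ)`. -/
def extensionGraph {V : Type*} (Γ : SimpleGraph V) : SimpleGraph (ExtVertex Γ) where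
  Adj x y := x ≠ y ∧ x.1 * y.1 = y.1 * x.1
  symm := ⟨fun _ _ h => ⟨h.1.symm, h.2.symm⟩⟩
  loopless := ⟨fun _ h => h.1 rfl⟩

/-- The right action of `A(Γ)` on the vertices of `Γ^e` by conjugation,
`x <• g = g⁻¹ x g`, so that `v^h <• g = v^(hg)`. -/
instance {V : Type*} (Γ : SimpleGraph V) : MulAction (RAAG Γ)ᵐᵒᵖ (ExtVertex Γ) where
  smul g x := ⟨g.unop⁻¹ * x.1 * g.unop, by
    obtain ⟨v, h, hx⟩ := x.2
    exact ⟨v, h * g.unop, by rw [hx]; group⟩⟩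
  one_smul x := Subtype.ext (by
    change (1 : RAAG Γ)⁻¹ * x.1 * 1 = x.1
    group)
  mul_smul g h x := Subtype.ext (by
    change (h.unop * g.unop)⁻¹ * x.1 * (h.unop * g.unop)
      = g.unop⁻¹ * (h.unop⁻¹ * x.1 * h.unop) * g.unop
    group)

/-- `t` is the asymptotic translation length of `g` for a right action on the vertices of the
graph `X` with its graph metric: `d(x gⁿ, x) / n → t` for every base vertex `x`. -/
def IsTranslationLength {G P : Type*} [Group G] [MulAction Gᵐᵒᵖ P] (X : SimpleGraph P)
    (g : G) (t : ℝ) : Prop :=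
  ∀ x : P, Filter.Tendsto (fun n : ℕ => (X.dist (x <• g ^ n) x : ℝ) / n) Filter.atTop (𝓝 t)

/-- The positive asymptotic translation lengths of elements of the subgroup `H`. -/
def loxodromicLengths {G P : Type*} [Group G] [MulAction Gᵐᵒᵖ P] (X : SimpleGraph P)
    (H : Subgroup G) : Set ℝ :=
  {t | 0 < t ∧ ∃ h ∈ H, IsTranslationLength X h t}

/-- The minimal asymptotic translation length of the subgroup `H`. -/
noncomputable def minTranslationLength {G P : Type*} [Group G] [MulAction Gᵐᵒᵖ P]
    (X : SimpleGraph P) (H : Subgroup G) : ℝ :=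
  sInf (loxodromicLengths X H)

end ExtensionGraph

/-!
Fix a reduced word `L`. The group `A(Γ)` acts on states `c : V → ℕ` in such a way that every suffix
of `L` sends `0` to its numbers of letters at the vertices: the generator `a` changes only the
coordinate `a`, by a permutation extending the steps that `L` prescribes, and the choice of this
permutation depends only on the coordinates not commuting with `a` (van der Waerden's trick). In
the orbit of `0`, any two noncommuting coordinates are the numbers of letters in a common suffix.

Let `L = Wⁿ`, and let the level of a coordinate be the number of copies of `W` needed to reach it.
Levels at two vertices adjacent in the complement of `Γ` then differ by at most one. The coordinates
off the star of `v` do not change under the centralizer of `v`, so that they are well defined at a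
vertex `v ^ h` of `Γ^e`. An edge of `Γ^e` is a simultaneous conjugate of an edge of `Γ`; if `W` is
supported neither in a star nor on a join, then along the edge the maximal level off the star rises
by at most `|V| - 2`, the length of a path in the complement. Since `Wⁿ` raises the level from `0`
to `n`, its displacement `d` satisfies `n ≤ d (|V| - 2)`. If `W` is supported in a star or on a
join, its powers have bounded orbits.
-/

namespace ExtensionGraph

variable {V : Type*} {Γ : SimpleGraph V}

section Words

variable (Γ) in
/-- The element of `A(Γ)` spelled by a word. As for free groups, the letters `(v, true)` and
`(v, false)` stand for `v` and `v⁻¹`. -/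
def wordProd (L : List (V × Bool)) : RAAG Γ := PresentedGroup.mk (raagRels Γ) (FreeGroup.mk L)

variable (Γ) in
/-- The element of `A(Γ)` given by a single letter. -/
def letter (l : V × Bool) : RAAG Γ := wordProd Γ [l]

lemma wordProd_nil : wordProd Γ [] = 1 := map_one (PresentedGroup.mk (raagRels Γ))

lemma wordProd_append (L M : List (V × Bool)) :
    wordProd Γ (L ++ M) = wordProd Γ L * wordProd Γ M := by
  simp only [wordProd, ← map_mul, FreeGroup.mul_mk]

lemma wordProd_cons (l : V × Bool) (L : List (V × Bool)) :
    wordProd Γ (l :: L) = letter Γ l * wordProd Γ L := wordProd_append [l] L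

lemma wordProd_invRev (L : List (V × Bool)) :
    wordProd Γ (FreeGroup.invRev L) = (wordProd Γ L)⁻¹ := by
  simp only [wordProd, ← map_inv, FreeGroup.inv_mk]

lemma wordProd_flatten_replicate (n : ℕ) (W : List (V × Bool)) :
    wordProd Γ (List.replicate n W).flatten = wordProd Γ W ^ n := by
  simp only [wordProd, ← map_pow, FreeGroup.pow_mk]

lemma wordProd_surjective : Function.Surjective (wordProd Γ) :=
  (PresentedGroup.mk_surjective _).comp Quot.mk_surjective

lemma letter_not (v : V) (e : Bool) : letter Γ (v, !e) = (letter Γ (v, e))⁻¹ :=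
  wordProd_invRev [(v, e)]

lemma gen_commute {v w : V} (h : Γ.Adj v w) : Commute (RAAG.gen Γ v) (RAAG.gen Γ w) := by
  have hrel : RAAG.gen Γ v * RAAG.gen Γ w * (RAAG.gen Γ v)⁻¹ * (RAAG.gen Γ w)⁻¹ = 1 :=
    PresentedGroup.one_of_mem ⟨v, w, h, rfl⟩
  exact mul_inv_eq_iff_eq_mul.mp (mul_inv_eq_one.mp hrel)

lemma letter_eq_gen_or_inv (l : V × Bool) :
    letter Γ l = RAAG.gen Γ l.1 ∨ letter Γ l = (RAAG.gen Γ l.1)⁻¹ := by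
  obtain ⟨v, _ | _⟩ := l
  · exact Or.inr (letter_not v true)
  · exact Or.inl rfl

lemma letter_commute {l m : V × Bool} (h : Γ.Adj l.1 m.1) :
    Commute (letter Γ l) (letter Γ m) := by
  rcases letter_eq_gen_or_inv (Γ := Γ) l with hl | hl <;>
    rcases letter_eq_gen_or_inv (Γ := Γ) m with hm | hm <;>
    simp [hl, hm, gen_commute h]

lemma letter_commute_wordProd {l : V × Bool} {L : List (V × Bool)}
    (h : ∀ q ∈ L, Γ.Adj l.1 q.1) : Commute (letter Γ l) (wordProd Γ L) := by
  induction L with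
  | nil => exact wordProd_nil (Γ := Γ) ▸ Commute.one_right _
  | cons q L ih =>
    rw [List.forall_mem_cons] at h
    exact wordProd_cons q L ▸ (letter_commute h.1).mul_right (ih h.2)

end Words

section ReducedWords

variable (Γ) in
/-- The letter `l` can be moved to the front of the word by commutations. -/
def IsInitial (l : V × Bool) : List (V × Bool) → Prop
  | [] => False
  | m :: L => m = l ∨ Γ.Adj l.1 m.1 ∧ IsInitial l L

variable (Γ) in
/-- The letter `l` can be moved to the end of the word by commutations. -/
def IsFinal (l : V × Bool) (L : List (V × Bool)) : Prop := IsInitial Γ l L.reverse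

variable (Γ) in
/-- A word is reduced if no letter can be moved by commutations next to a later inverse of it. -/
def IsReducedWord : List (V × Bool) → Prop
  | [] => True
  | l :: L => ¬ IsInitial Γ (l.1, !l.2) L ∧ IsReducedWord L

lemma isInitial_append {l : V × Bool} {L M : List (V × Bool)} :
    IsInitial Γ l (L ++ M) ↔
      IsInitial Γ l L ∨ (∀ q ∈ L, Γ.Adj l.1 q.1) ∧ IsInitial Γ l M := by
  induction L with
  | nil => simp [IsInitial]
  | cons m L ih => simp only [List.cons_append, IsInitial, ih, List.forall_mem_cons]; tauto

lemma isInitial_singleton {l m : V × Bool} : IsInitial Γ l [m] ↔ m = l := by simp [IsInitial]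

lemma isFinal_cons {l m : V × Bool} {L : List (V × Bool)} :
    IsFinal Γ l (m :: L) ↔ IsFinal Γ l L ∨ m = l ∧ ∀ q ∈ L, Γ.Adj l.1 q.1 := by
  simp only [IsFinal, List.reverse_cons, isInitial_append, isInitial_singleton, List.mem_reverse,
    and_comm]

lemma IsInitial.mem {l : V × Bool} {L : List (V × Bool)} (h : IsInitial Γ l L) : l ∈ L := by
  induction L with
  | nil => exact h.elim
  | cons m L ih =>
    rcases h with rfl | ⟨-, h⟩
    · exact List.mem_cons_self
    · exact List.mem_cons_of_mem _ (ih h)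

lemma IsFinal.mem {l : V × Bool} {L : List (V × Bool)} (h : IsFinal Γ l L) : l ∈ L :=
  List.mem_reverse.mp (IsInitial.mem h)

lemma isInitial_map_not {l : V × Bool} {L : List (V × Bool)} :
    IsInitial Γ l (L.map fun m => (m.1, !m.2)) ↔ IsInitial Γ (l.1, !l.2) L := by
  induction L with
  | nil => simp [IsInitial]
  | cons m L ih => simp [IsInitial, ih, Prod.ext_iff, Bool.not_eq_eq_eq_not]

lemma isFinal_invRev {l : V × Bool} {L : List (V × Bool)} :
    IsFinal Γ l (FreeGroup.invRev L) ↔ IsInitial Γ (l.1, !l.2) L := by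
  rw [IsFinal, FreeGroup.invRev, List.reverse_reverse, isInitial_map_not]

lemma isInitial_invRev {l : V × Bool} {L : List (V × Bool)} :
    IsInitial Γ l (FreeGroup.invRev L) ↔ IsFinal Γ (l.1, !l.2) L := by
  rw [IsFinal, FreeGroup.invRev, ← List.map_reverse, isInitial_map_not]

lemma isReducedWord_append {L M : List (V × Bool)} :
    IsReducedWord Γ (L ++ M) ↔ IsReducedWord Γ L ∧ IsReducedWord Γ M ∧
      ∀ l, IsFinal Γ l L → ¬ IsInitial Γ (l.1, !l.2) M := by
  induction L with
  | nil => simp [IsReducedWord, IsFinal, IsInitial]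
  | cons m L ih =>
    simp only [List.cons_append, IsReducedWord, ih, isInitial_append, isFinal_cons, or_imp,
      forall_and, and_imp, forall_eq']
    tauto

lemma IsReducedWord.of_isSuffix {L D : List (V × Bool)} (hL : IsReducedWord Γ L)
    (h : D <:+ L) : IsReducedWord Γ D := by
  obtain ⟨P, rfl⟩ := h
  exact (isReducedWord_append.mp hL).2.1

lemma IsReducedWord.invRev {L : List (V × Bool)} (hL : IsReducedWord Γ L) :
    IsReducedWord Γ (FreeGroup.invRev L) := by
  induction L with
  | nil => trivial
  | cons l L ih =>
    rw [FreeGroup.invRev_cons, isReducedWord_append]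
    refine ⟨ih hL.2, ⟨not_false, trivial⟩, fun m hm hm' => hL.1 ?_⟩
    obtain rfl : l = m := by simpa [isInitial_singleton, FreeGroup.invRev, Prod.ext_iff] using hm'
    exact isFinal_invRev.mp hm

lemma IsInitial.exists_wordProd_eq {l : V × Bool} {L : List (V × Bool)} (h : IsInitial Γ l L) :
    ∃ M, M.length + 1 = L.length ∧ wordProd Γ L = letter Γ l * wordProd Γ M := by
  induction L with
  | nil => exact h.elim
  | cons m L ih =>
    rcases h with rfl | ⟨hadj, h⟩
    · exact ⟨L, rfl, wordProd_cons m L⟩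
    · obtain ⟨M, hlen, hM⟩ := ih h
      refine ⟨m :: M, by simp [hlen], ?_⟩
      rw [wordProd_cons, wordProd_cons, hM, (letter_commute hadj).left_comm]

lemma IsFinal.exists_wordProd_eq {l : V × Bool} {L : List (V × Bool)} (h : IsFinal Γ l L) :
    ∃ M, M.length + 1 = L.length ∧ wordProd Γ L = wordProd Γ M * letter Γ l := by
  induction L with
  | nil => exact h.elim
  | cons m L ih =>
    rcases isFinal_cons.mp h with h | ⟨rfl, hadj⟩
    · obtain ⟨M, hlen, hM⟩ := ih h
      exact ⟨m :: M, by simp [hlen], by rw [wordProd_cons, wordProd_cons, hM, mul_assoc]⟩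
    · exact ⟨L, rfl, by rw [wordProd_cons, (letter_commute_wordProd hadj).eq]⟩

lemma exists_wordProd_eq_of_isInitial_of_isFinal {l m : V × Bool} {L : List (V × Bool)}
    (hl : IsInitial Γ l L) (hm : IsFinal Γ m L) (hlm : l ≠ m) :
    ∃ M, M.length + 2 = L.length ∧
      wordProd Γ L = letter Γ l * wordProd Γ M * letter Γ m := by
  induction L with
  | nil => exact hl.elim
  | cons q L ih =>
    rcases hl with rfl | ⟨hadj, hl⟩ <;> rcases isFinal_cons.mp hm with hm | ⟨rfl, hadj'⟩
    · obtain ⟨M, hlen, hM⟩ := hm.exists_wordProd_eq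
      exact ⟨M, by simp [← hlen], by rw [wordProd_cons, hM, mul_assoc]⟩
    · exact absurd rfl hlm
    · obtain ⟨M, hlen, hM⟩ := ih hl hm
      refine ⟨q :: M, by simp [← hlen], ?_⟩
      simp only [wordProd_cons, hM, mul_assoc, (letter_commute hadj).left_comm]
    · obtain ⟨M, hlen, hM⟩ := hl.exists_wordProd_eq
      exact ⟨M, by simp [← hlen], by rw [wordProd_cons, (letter_commute_wordProd hadj').eq, hM]⟩

lemma exists_shorter_of_not_isReducedWord {L : List (V × Bool)} (h : ¬ IsReducedWord Γ L) :
    ∃ M, M.length < L.length ∧ wordProd Γ M = wordProd Γ L := by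
  induction L with
  | nil => exact absurd trivial h
  | cons l L ih =>
    by_cases hl : IsInitial Γ (l.1, !l.2) L
    · obtain ⟨M, hlen, hM⟩ := hl.exists_wordProd_eq
      refine ⟨M, by simp [← hlen], ?_⟩
      rw [wordProd_cons, hM, letter_not, mul_inv_cancel_left]
    · obtain ⟨M, hlen, hM⟩ := ih fun hL => h ⟨hl, hL⟩
      exact ⟨l :: M, by simpa using hlen, by rw [wordProd_cons, wordProd_cons, hM]⟩

lemma isReducedWord_of_forall_snd {L : List (V × Bool)} (hL : ∀ l ∈ L, l.2 = true) :
    IsReducedWord Γ L := by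
  induction L with
  | nil => trivial
  | cons l L ih =>
    rw [List.forall_mem_cons] at hL
    refine ⟨fun h => ?_, ih hL.2⟩
    simpa [hL.1] using hL.2 _ h.mem

lemma isReducedWord_flatten_replicate {W : List (V × Bool)} (hW : IsReducedWord Γ (W ++ W))
    (n : ℕ) : IsReducedWord Γ (List.replicate n W).flatten := by
  obtain ⟨hred, -, hcyc⟩ := isReducedWord_append.mp hW
  induction n with
  | zero => trivial
  | succ n ih =>
    rw [List.replicate_succ, List.flatten_cons, isReducedWord_append]
    refine ⟨hred, ih, fun l hl hinit => ?_⟩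
    cases n with
    | zero => exact hinit
    | succ n =>
      rw [List.replicate_succ, List.flatten_cons, isInitial_append] at hinit
      rcases hinit with hinit | ⟨hadj, -⟩
      · exact hcyc l hl hinit
      · exact Γ.irrefl (hadj l hl.mem)

lemma exists_shortest_wordProd_mem {S : Set (RAAG Γ)} (hS : S.Nonempty) :
    ∃ L, wordProd Γ L ∈ S ∧ ∀ M, wordProd Γ M ∈ S → L.length ≤ M.length := by
  obtain ⟨L, hL, hmin⟩ := (measure List.length).wf.has_min (wordProd Γ ⁻¹' S)
    (hS.preimage wordProd_surjective)
  exact ⟨L, hL, fun M hM => not_lt.mp (hmin M hM)⟩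

lemma isReducedWord_of_forall_length_le {L : List (V × Bool)}
    (hmin : ∀ M, wordProd Γ M = wordProd Γ L → L.length ≤ M.length) : IsReducedWord Γ L := by
  by_contra h
  obtain ⟨M, hlt, hM⟩ := exists_shorter_of_not_isReducedWord h
  exact absurd (hmin M hM) (by omega)

lemma exists_isConj_wordProd_isReducedWord (g : RAAG Γ) :
    ∃ W, IsConj g (wordProd Γ W) ∧ IsReducedWord Γ (W ++ W) := by
  obtain ⟨W, hgW, hmin⟩ := exists_shortest_wordProd_mem (S := {h | IsConj g h}) ⟨g, .refl g⟩
  have hred : IsReducedWord Γ W := isReducedWord_of_forall_length_le fun M hM =>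
    hmin M (show IsConj g (wordProd Γ M) from hM ▸ hgW)
  refine ⟨W, hgW, isReducedWord_append.mpr ⟨hred, hred, fun l hfin hinit => ?_⟩⟩
  obtain ⟨M, hlen, hM⟩ := exists_wordProd_eq_of_isInitial_of_isFinal hinit hfin
    (by simp [Prod.ext_iff])
  have hWM : IsConj (wordProd Γ W) (wordProd Γ M) := isConj_iff.mpr ⟨letter Γ l, by
    rw [hM, letter_not]; group⟩
  exact absurd (hmin M (hgW.trans hWM)) (by omega)

end ReducedWords

section VertexCount

variable [DecidableEq V]

/-- The number of letters of a word, of either sign, at a given vertex. -/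
def vertexCount (u : V) (L : List (V × Bool)) : ℕ := (L.map Prod.fst).count u

lemma vertexCount_append (u : V) (L M : List (V × Bool)) :
    vertexCount u (L ++ M) = vertexCount u L + vertexCount u M := by
  simp only [vertexCount, List.map_append, List.count_append]

lemma vertexCount_cons_self (u : V) (e : Bool) (L : List (V × Bool)) :
    vertexCount u ((u, e) :: L) = vertexCount u L + 1 := List.count_cons_self

lemma vertexCount_cons_of_ne {u v : V} (h : u ≠ v) (e : Bool) (L : List (V × Bool)) :
    vertexCount u ((v, e) :: L) = vertexCount u L := List.count_cons_of_ne h.symm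

lemma vertexCount_cons (l : V × Bool) (L : List (V × Bool)) :
    (fun u => vertexCount u (l :: L)) =
      Function.update (fun u => vertexCount u L) l.1 (vertexCount l.1 L + 1) := by
  ext u
  rcases eq_or_ne u l.1 with rfl | h
  · rw [Function.update_self, vertexCount_cons_self]
  · rw [Function.update_of_ne h, vertexCount_cons_of_ne h]

lemma vertexCount_pos {u : V} {L : List (V × Bool)} :
    0 < vertexCount u L ↔ u ∈ L.map Prod.fst := List.count_pos_iff

lemma vertexCount_le_of_isSuffix {D E : List (V × Bool)} (h : D <:+ E) (u : V) :
    vertexCount u D ≤ vertexCount u E := (h.sublist.map Prod.fst).count_le u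

lemma isSuffix_of_vertexCount_lt {L D E : List (V × Bool)} (hD : D <:+ L) (hE : E <:+ L) {u : V}
    (h : vertexCount u D < vertexCount u E) : D <:+ E :=
  (List.suffix_or_suffix_of_suffix hD hE).resolve_right fun h' =>
    (vertexCount_le_of_isSuffix h' u).not_gt h

end VertexCount

section StepRelation

variable [DecidableEq V] {L : List (V × Bool)}

variable (L) in
/-- The word `L` prescribes that the generator `a` moves the coordinate `a` from `x` to `y`: for
every suffix `(a, e) :: D` of `L`, the letter `(a, e)` moves it from `vertexCount a D` to
`vertexCount a D + 1`. -/
def Step (a : V) (x y : ℕ) : Prop :=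
  (∃ D, (a, true) :: D <:+ L ∧ vertexCount a D = x ∧ y = x + 1) ∨
    ∃ D, (a, false) :: D <:+ L ∧ vertexCount a D = y ∧ x = y + 1

variable (Γ L) in
/-- The values of the coordinate `a` which together with each coordinate `c w`, for `w` not
commuting with `a`, are the numbers of letters at `a` and `w` in a suffix of `L`. -/
def admissible (a : V) (c : V → ℕ) : Set ℕ :=
  {x | x ≤ vertexCount a L ∧
    ∀ w, w ≠ a → ¬ Γ.Adj a w → ∃ D, D <:+ L ∧ vertexCount a D = x ∧ vertexCount w D = c w}

lemma vertexCount_mem_admissible {D : List (V × Bool)} (hD : D <:+ L) (a : V) :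
    vertexCount a D ∈ admissible Γ L a (vertexCount · D) :=
  ⟨vertexCount_le_of_isSuffix hD a, fun _ _ _ => ⟨D, hD, rfl, rfl⟩⟩

lemma admissible_update {a b : V} (h : b = a ∨ Γ.Adj a b) (c : V → ℕ) (y : ℕ) :
    admissible Γ L a (Function.update c b y) = admissible Γ L a c := by
  ext x
  refine and_congr_right fun _ => forall₃_congr fun w hwa hadj => ?_
  rw [Function.update_of_ne]
  rintro rfl
  exact h.elim hwa hadj

lemma IsReducedWord.exists_vertexCount_lt {a : V} {e : Bool} {D E : List (V × Bool)}
    (hE : IsReducedWord Γ ((a, e) :: E)) (hDE : (a, !e) :: D <:+ E)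
    (h : vertexCount a E = vertexCount a D + 1) :
    ∃ w, w ≠ a ∧ ¬ Γ.Adj a w ∧ vertexCount w D < vertexCount w E := by
  obtain ⟨Q, rfl⟩ := hDE
  have hnot : ¬ ∀ q ∈ Q, Γ.Adj a q.1 := fun hadj =>
    hE.1 (isInitial_append.mpr (Or.inr ⟨hadj, Or.inl rfl⟩))
  push Not at hnot
  obtain ⟨q, hq, hadj⟩ := hnot
  have hpos : 0 < vertexCount q.1 Q := vertexCount_pos.mpr (List.mem_map_of_mem hq)
  rw [vertexCount_append, vertexCount_cons_self] at h
  have hqa : q.1 ≠ a := by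
    intro hqa
    rw [hqa] at hpos
    omega
  refine ⟨q.1, hqa, hadj, ?_⟩
  rw [vertexCount_append, vertexCount_cons_of_ne hqa]
  omega

/-- If the signs differed, a letter at some `w` not commuting with `a` would lie between the two
letters at `a`. But the coordinate `c w` is compatible with `a` standing before and after both. -/
lemma eq_of_mem_admissible (hL : IsReducedWord Γ L) {a : V} {c : V → ℕ}
    {D E : List (V × Bool)} {e f : Bool} (hD : (a, e) :: D <:+ L) (hE : (a, f) :: E <:+ L)
    (h : vertexCount a E = vertexCount a D + 1) (h₀ : vertexCount a D ∈ admissible Γ L a c)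
    (h₂ : vertexCount a D + 2 ∈ admissible Γ L a c) : e = f := by
  by_contra hef
  obtain rfl : e = !f := Bool.eq_not.mpr hef
  have hE' : E <:+ L := (List.suffix_cons _ _).trans hE
  have hDE : (a, !f) :: D <:+ E := by
    have hDE' : (a, !f) :: D <:+ (a, f) :: E := isSuffix_of_vertexCount_lt hD hE (u := a) (by
      simp only [vertexCount_cons_self]; omega)
    exact (List.suffix_cons_iff.mp hDE').resolve_left (by simp)
  obtain ⟨w, hwa, hadj, hlt⟩ := (hL.of_isSuffix hE).exists_vertexCount_lt hDE h
  obtain ⟨F, hF, hFa, hFw⟩ := h₀.2 w hwa hadj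
  obtain ⟨G, hG, hGa, hGw⟩ := h₂.2 w hwa hadj
  have hFD : F <:+ (a, !f) :: D := isSuffix_of_vertexCount_lt hF hD (u := a) (by
    rw [vertexCount_cons_self]; omega)
  have hEG : E <:+ G := isSuffix_of_vertexCount_lt hE' hG (u := a) (by omega)
  have hc : c w < c w := calc
    c w = vertexCount w F := hFw.symm
    _ ≤ vertexCount w ((a, !f) :: D) := vertexCount_le_of_isSuffix hFD w
    _ = vertexCount w D := vertexCount_cons_of_ne hwa _ _
    _ < vertexCount w E := hlt
    _ ≤ c w := hGw ▸ vertexCount_le_of_isSuffix hEG w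
  exact hc.false

lemma Step.right_unique (hL : IsReducedWord Γ L) {a : V} {c : V → ℕ} {x y z : ℕ}
    (hy : y ∈ admissible Γ L a c) (hz : z ∈ admissible Γ L a c)
    (h : Step L a x y) (h' : Step L a x z) : y = z := by
  rcases h with ⟨D, hD, rfl, rfl⟩ | ⟨D, hD, rfl, hx⟩ <;>
    rcases h' with ⟨E, hE, hx', rfl⟩ | ⟨E, hE, rfl, hx'⟩
  · rfl
  · exact absurd (eq_of_mem_admissible hL hE hD hx' hz (by rwa [hx'] at hy)) (by simp)
  · exact absurd (eq_of_mem_admissible hL hD hE (by omega) hy (by rwa [hx] at hz)) (by simp)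
  · omega

lemma Step.left_unique (hL : IsReducedWord Γ L) {a : V} {c : V → ℕ} {x y z : ℕ}
    (hx : x ∈ admissible Γ L a c) (hy : y ∈ admissible Γ L a c)
    (h : Step L a x z) (h' : Step L a y z) : x = y := by
  rcases h with ⟨D, hD, rfl, hz⟩ | ⟨D, hD, rfl, rfl⟩ <;>
    rcases h' with ⟨E, hE, rfl, hz'⟩ | ⟨E, hE, hz', rfl⟩
  · omega
  · exact absurd (eq_of_mem_admissible hL hD hE (by omega) hx (by rwa [hz] at hy)) (by simp)
  · exact absurd (eq_of_mem_admissible hL hE hD (by omega) hy (by rwa [hz'] at hx)) (by simp)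
  · rfl

end StepRelation

section Representation

variable [DecidableEq V] {L : List (V × Bool)}

lemma exists_perm_of_biUnique {α : Type*} [Finite α] {r : α → α → Prop}
    (hr : Relator.BiUnique r) : ∃ π : Equiv.Perm α, ∀ x y, r x y → π x = y := by
  classical
  have := Fintype.ofFinite α
  choose! f hf using fun x (h : ∃ y, r x y) => h
  have hinj : Set.InjOn f {x | ∃ y, r x y} := fun x hx y hy hxy =>
    hr.1 (hf x hx) (hxy ▸ hf y hy)
  obtain ⟨π, hπ⟩ := Set.MapsTo.exists_equiv_extend_of_card_eq (t := Finset.univ)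
    Finset.card_univ.symm (fun _ _ => Finset.mem_coe.mpr (Finset.mem_univ _)) hinj
  exact ⟨π.trans (Equiv.subtypeUnivEquiv Finset.mem_univ), fun x y h =>
    (hπ x ⟨y, h⟩).trans (hr.2 (hf x ⟨y, h⟩) h)⟩

variable (L) in
/-- The permutation `π` preserves the set `I` of values of the coordinate `a` and realizes the
steps that `L` prescribes between them. -/
def RealizesSteps (a : V) (I : Set ℕ) (π : Equiv.Perm ℕ) : Prop :=
  (∀ x, π x ∈ I ↔ x ∈ I) ∧ ∀ x ∈ I, ∀ y ∈ I, Step L a x y → π x = y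

lemma exists_realizesSteps (hL : IsReducedWord Γ L) (a : V) (c : V → ℕ) :
    ∃ π, RealizesSteps L a (admissible Γ L a c) π := by
  classical
  have : Finite (admissible Γ L a c) :=
    ((Set.finite_Iic (vertexCount a L)).subset fun _ hx => hx.1).to_subtype
  obtain ⟨π, hπ⟩ := exists_perm_of_biUnique
    (r := fun x y : admissible Γ L a c => Step L a x y)
    ⟨fun x y _ h h' => Subtype.ext (Step.left_unique hL x.2 y.2 h h'),
      fun _ y z h h' => Subtype.ext (Step.right_unique hL y.2 z.2 h h')⟩
  refine ⟨Equiv.Perm.ofSubtype π, Equiv.Perm.ofSubtype_apply_mem_iff_mem π, fun x hx y hy h => ?_⟩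
  rw [Equiv.Perm.ofSubtype_apply_of_mem π hx, hπ ⟨x, hx⟩ ⟨y, hy⟩ h]

variable (L) in
/-- A permutation through which the letter `l` acts on its coordinate when `I` is the set of
admissible values of that coordinate. The choice is junk if no permutation realizes the steps, which
can only happen if `L` is not reduced. -/
noncomputable def stepPerm (l : V × Bool) (I : Set ℕ) : Equiv.Perm ℕ :=
  let π := Classical.epsilon (RealizesSteps L l.1 I)
  cond l.2 π π⁻¹

lemma stepPerm_not (a : V) (e : Bool) (I : Set ℕ) :
    stepPerm L (a, !e) I = (stepPerm L (a, e) I)⁻¹ := by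
  cases e
  · exact (inv_inv _).symm
  · rfl

lemma stepPerm_mem_admissible (hL : IsReducedWord Γ L) (l : V × Bool) {c : V → ℕ} {x : ℕ}
    (hx : x ∈ admissible Γ L l.1 c) :
    stepPerm L l (admissible Γ L l.1 c) x ∈ admissible Γ L l.1 c := by
  have hmem := (Classical.epsilon_spec (exists_realizesSteps hL l.1 c)).1
  obtain ⟨a, _ | _⟩ := l
  · exact (hmem _).mp (by rwa [stepPerm, cond_false, Equiv.Perm.inv_def, Equiv.apply_symm_apply])
  · exact (hmem x).mpr hx

lemma stepPerm_vertexCount (hL : IsReducedWord Γ L) {l : V × Bool} {D : List (V × Bool)}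
    (hD : l :: D <:+ L) :
    stepPerm L l (admissible Γ L l.1 (vertexCount · D)) (vertexCount l.1 D) =
      vertexCount l.1 D + 1 := by
  have hx := vertexCount_mem_admissible (Γ := Γ) ((List.suffix_cons _ _).trans hD) l.1
  have hy := vertexCount_mem_admissible (Γ := Γ) hD l.1
  have hstep := (Classical.epsilon_spec
    (exists_realizesSteps hL l.1 (vertexCount · D))).2
  rw [vertexCount_cons, admissible_update (Or.inl rfl), vertexCount_cons_self] at hy
  obtain ⟨a, _ | _⟩ := l
  · rw [stepPerm, cond_false, Equiv.Perm.inv_eq_iff_eq]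
    exact (hstep _ hy _ hx (Or.inr ⟨D, hD, rfl, rfl⟩)).symm
  · exact hstep _ hx _ hy (Or.inl ⟨D, hD, rfl, rfl⟩)

variable (Γ L) in
/-- The permutation of the states by which a letter acts. It changes only one coordinate, in a way
that depends only on the coordinates at vertices not commuting with the letter. -/
noncomputable def letterPerm (l : V × Bool) : Equiv.Perm (V → ℕ) where
  toFun c := Function.update c l.1 (stepPerm L l (admissible Γ L l.1 c) (c l.1))
  invFun c := Function.update c l.1 ((stepPerm L l (admissible Γ L l.1 c))⁻¹ (c l.1))
  left_inv c := by simp [admissible_update]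
  right_inv c := by simp [admissible_update]

lemma letterPerm_apply (l : V × Bool) (c : V → ℕ) : letterPerm Γ L l c =
    Function.update c l.1 (stepPerm L l (admissible Γ L l.1 c) (c l.1)) := rfl

lemma letterPerm_not (a : V) (e : Bool) :
    letterPerm Γ L (a, !e) = (letterPerm Γ L (a, e))⁻¹ := by
  ext1 c
  rw [letterPerm_apply, stepPerm_not]
  rfl

lemma letterPerm_commute {l m : V × Bool} (h : Γ.Adj l.1 m.1) :
    Commute (letterPerm Γ L l) (letterPerm Γ L m) := by
  ext1 c
  simp only [Equiv.Perm.mul_apply, letterPerm_apply]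
  rw [admissible_update (Or.inr h), admissible_update (Or.inr h.symm),
    Function.update_of_ne h.ne, Function.update_of_ne h.ne', Function.update_comm h.ne']

variable (Γ L) in
/-- The action of `A(Γ)` on states which the word `L` determines. -/
noncomputable def wordRep : RAAG Γ →* Equiv.Perm (V → ℕ) :=
  PresentedGroup.toGroup (f := fun a => letterPerm Γ L (a, true)) <| by
    rintro r ⟨v, w, h, rfl⟩
    simp only [map_mul, map_inv, FreeGroup.lift_apply_of]
    exact mul_inv_eq_one.mpr (mul_inv_eq_iff_eq_mul.mpr (letterPerm_commute h))

lemma wordRep_letter (l : V × Bool) : wordRep Γ L (letter Γ l) = letterPerm Γ L l := by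
  have hgen (a : V) : wordRep Γ L (letter Γ (a, true)) = letterPerm Γ L (a, true) :=
    PresentedGroup.toGroup.of _
  obtain ⟨a, _ | _⟩ := l
  · exact (congrArg _ (letter_not a true)).trans ((map_inv _ _).trans
      ((congrArg _ (hgen a)).trans (letterPerm_not a true).symm))
  · exact hgen a

lemma wordRep_wordProd_cons (l : V × Bool) (W : List (V × Bool)) (c : V → ℕ) :
    wordRep Γ L (wordProd Γ (l :: W)) c = letterPerm Γ L l (wordRep Γ L (wordProd Γ W) c) := by
  rw [wordProd_cons, map_mul, wordRep_letter, Equiv.Perm.mul_apply]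

lemma wordRep_isSuffix (hL : IsReducedWord Γ L) {D : List (V × Bool)} (hD : D <:+ L) :
    wordRep Γ L (wordProd Γ D) 0 = (vertexCount · D) := by
  induction D with
  | nil => rw [wordProd_nil, map_one]; rfl
  | cons l D ih =>
    rw [wordRep_wordProd_cons, ih ((List.suffix_cons _ _).trans hD), letterPerm_apply,
      stepPerm_vertexCount hL hD, ← vertexCount_cons]

variable (Γ L) in
/-- A state is valid if any two coordinates at non-commuting vertices are the numbers of letters
at these vertices in a suffix of `L`. -/
def IsValidState (c : V → ℕ) : Prop := ∀ a, c a ∈ admissible Γ L a c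

lemma IsValidState.update {c : V → ℕ} (hc : IsValidState Γ L c) {a : V} {x : ℕ}
    (hx : x ∈ admissible Γ L a c) : IsValidState Γ L (Function.update c a x) := by
  intro b
  rcases eq_or_ne b a with rfl | hb
  · rwa [admissible_update (Or.inl rfl), Function.update_self]
  rw [Function.update_of_ne hb]
  refine ⟨(hc b).1, fun w hw hadj => ?_⟩
  rcases eq_or_ne w a with rfl | hwa
  · obtain ⟨D, hD, hDw, hDb⟩ := hx.2 b hb fun h => hadj h.symm
    exact ⟨D, hD, hDb, by rw [hDw, Function.update_self]⟩
  · rw [Function.update_of_ne hwa]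
    exact (hc b).2 w hw hadj

lemma isValidState_wordRep (hL : IsReducedWord Γ L) (g : RAAG Γ) :
    IsValidState Γ L (wordRep Γ L g 0) := by
  obtain ⟨W, rfl⟩ := wordProd_surjective g
  induction W with
  | nil =>
    rw [wordProd_nil, map_one]
    exact vertexCount_mem_admissible List.nil_suffix
  | cons l W ih =>
    rw [wordRep_wordProd_cons, letterPerm_apply]
    exact ih.update (stepPerm_mem_admissible hL l (ih l.1))

end Representation

section Parabolic

variable (Γ) in
/-- A vertex together with its neighbours. -/
def closedStar (w : V) : Set V := insert w (Γ.neighborSet w)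

variable (Γ) in
/-- The (standard) parabolic subgroup of `A(Γ)` generated by a set of vertices. -/
def parabolic (A : Set V) : Subgroup (RAAG Γ) := Subgroup.closure (RAAG.gen Γ '' A)

lemma gen_mem_parabolic {A : Set V} {v : V} (hv : v ∈ A) : RAAG.gen Γ v ∈ parabolic Γ A :=
  Subgroup.subset_closure (Set.mem_image_of_mem _ hv)

lemma letter_mem_parabolic {A : Set V} {l : V × Bool} (hl : l.1 ∈ A) :
    letter Γ l ∈ parabolic Γ A := by
  rcases letter_eq_gen_or_inv (Γ := Γ) l with h | h <;> rw [h]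
  · exact gen_mem_parabolic hl
  · exact inv_mem (gen_mem_parabolic hl)

lemma wordProd_mem_parabolic {A : Set V} {L : List (V × Bool)} (h : ∀ l ∈ L, l.1 ∈ A) :
    wordProd Γ L ∈ parabolic Γ A := by
  induction L with
  | nil => exact wordProd_nil (Γ := Γ) ▸ one_mem _
  | cons l L ih =>
    rw [List.forall_mem_cons] at h
    exact wordProd_cons l L ▸ mul_mem (letter_mem_parabolic h.1) (ih h.2)

lemma commute_of_mem_parabolic {A B : Set V}
    (hAB : ∀ a ∈ A, ∀ b ∈ B, Commute (RAAG.gen Γ a) (RAAG.gen Γ b)) {g h : RAAG Γ}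
    (hg : g ∈ parabolic Γ A) (hh : h ∈ parabolic Γ B) : Commute g h := by
  have hle : parabolic Γ A ≤ Subgroup.centralizer (parabolic Γ B) := by
    rw [parabolic, parabolic, Subgroup.centralizer_closure, Subgroup.closure_le]
    rintro _ ⟨a, ha, rfl⟩ _ ⟨b, hb, rfl⟩
    exact (hAB a ha b hb).symm
  exact (Subgroup.mem_centralizer_iff.mp (hle hg) h hh).symm

lemma wordRep_apply_of_mem_parabolic [DecidableEq V] {L : List (V × Bool)} {A : Set V} {u : V}
    (hu : u ∉ A) {g : RAAG Γ} (hg : g ∈ parabolic Γ A) (c : V → ℕ) :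
    wordRep Γ L g c u = c u := by
  induction hg using Subgroup.closure_induction generalizing c with
  | mem x hx =>
    obtain ⟨a, ha, rfl⟩ := hx
    rw [show RAAG.gen Γ a = letter Γ (a, true) from rfl, wordRep_letter, letterPerm_apply,
      Function.update_of_ne (ne_of_mem_of_not_mem ha hu).symm]
  | one => rw [map_one, Equiv.Perm.one_apply]
  | mul x y _ _ hx hy => rw [map_mul, Equiv.Perm.mul_apply, hx, hy]
  | inv x _ hx =>
    rw [← hx (wordRep Γ L x⁻¹ c), ← Equiv.Perm.mul_apply, ← map_mul, mul_inv_cancel, map_one,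
      Equiv.Perm.one_apply]

lemma isReducedWord_conj_of_forall_length_le {w : V} {W : List (V × Bool)}
    (hmin : ∀ M, (wordProd Γ W)⁻¹ * wordProd Γ M ∈ parabolic Γ (closedStar Γ w) →
      W.length ≤ M.length) :
    IsReducedWord Γ (W ++ (w, true) :: FreeGroup.invRev W) := by
  have hred : IsReducedWord Γ W := isReducedWord_of_forall_length_le fun M hM =>
    hmin M (by rw [hM, inv_mul_cancel]; exact one_mem _)
  have hstar (l : V × Bool) (hl : IsFinal Γ l W) : l.1 ∉ closedStar Γ w := by
    intro hlw
    obtain ⟨M, hlen, hM⟩ := hl.exists_wordProd_eq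
    have hmem : (wordProd Γ W)⁻¹ * wordProd Γ M ∈ parabolic Γ (closedStar Γ w) := by
      rw [hM, mul_inv_rev, inv_mul_cancel_right]
      exact inv_mem (letter_mem_parabolic hlw)
    exact absurd (hmin M hmem) (by omega)
  refine isReducedWord_append.mpr ⟨hred, ⟨fun h => ?_, hred.invRev⟩, ?_⟩
  · exact hstar _ (isInitial_invRev.mp h) (Set.mem_insert _ _)
  · rintro l hl (h | ⟨h, -⟩)
    · exact hstar l hl (Or.inl (congrArg Prod.fst h).symm)
    · exact hstar l hl (Or.inr h.symm)

/-- If `W` is a shortest word in the coset of `g`, then the reduced word `W w W⁻¹` spells `w`. All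
its letters other than `w` being invisible in the count, `W` has none outside the star of `w`. -/
theorem commute_gen_iff {w : V} {g : RAAG Γ} :
    Commute g (RAAG.gen Γ w) ↔ g ∈ parabolic Γ (closedStar Γ w) := by
  classical
  have hstar {s : RAAG Γ} (hs : s ∈ parabolic Γ (closedStar Γ w)) : Commute s (RAAG.gen Γ w) := by
    refine commute_of_mem_parabolic ?_ hs (gen_mem_parabolic (Set.mem_singleton w))
    rintro a (rfl | ha) b rfl
    exacts [Commute.refl _, gen_commute ha.symm]
  refine ⟨fun hg => ?_, hstar⟩
  obtain ⟨W, hgW, hmin⟩ := exists_shortest_wordProd_mem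
    (S := {x | g⁻¹ * x ∈ parabolic Γ (closedStar Γ w)}) ⟨g, by simp⟩
  have hred := isReducedWord_conj_of_forall_length_le (w := w) fun M hM => hmin M <| by
    simpa [mul_assoc] using mul_mem hgW hM
  have hcomm : Commute (wordProd Γ W) (RAAG.gen Γ w) := by
    simpa using hg.mul_left (hstar hgW)
  have hprod : wordProd Γ (W ++ (w, true) :: FreeGroup.invRev W) = RAAG.gen Γ w := by
    rw [wordProd_append, wordProd_cons, wordProd_invRev, ← mul_assoc]
    exact mul_inv_eq_iff_eq_mul.mpr hcomm.eq
  have hW : ∀ l ∈ W, l.1 ∈ closedStar Γ w := by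
    intro l hl
    by_contra hlw
    have hcount := congrFun (wordRep_isSuffix hred List.suffix_rfl) l.1
    rw [hprod, wordRep_apply_of_mem_parabolic (A := closedStar Γ w) hlw
      (gen_mem_parabolic (Set.mem_insert _ _)), Pi.zero_apply, vertexCount_append] at hcount
    have hpos := vertexCount_pos.mpr (List.mem_map_of_mem (f := Prod.fst) hl)
    omega
  simpa using mul_mem (wordProd_mem_parabolic hW) (inv_mem hgW)

end Parabolic

section Homomorphisms

variable (Γ) in
/-- The abelianization of `A(Γ)`: the exponent sums of the vertices. -/
noncomputable def exponentVector : RAAG Γ →* Multiplicative (V →₀ ℤ) :=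
  PresentedGroup.toGroup (f := fun v => Multiplicative.ofAdd (Finsupp.single v 1)) <| by
    rintro r ⟨v, w, -, rfl⟩
    simp only [map_mul, map_inv, mul_inv_cancel_comm, mul_inv_cancel]

lemma exponentVector_gen (v : V) :
    exponentVector Γ (RAAG.gen Γ v) = Multiplicative.ofAdd (Finsupp.single v 1) :=
  PresentedGroup.toGroup.of _

lemma gen_ne_one (v : V) : RAAG.gen Γ v ≠ 1 := by
  intro h
  have hv := exponentVector_gen (Γ := Γ) v
  rw [h, map_one, eq_comm, ofAdd_eq_one] at hv
  exact one_ne_zero (Finsupp.single_eq_zero.mp hv)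

lemma eq_of_isConj_gen {v w : V} (h : IsConj (RAAG.gen Γ v) (RAAG.gen Γ w)) : v = w := by
  have h' := isConj_iff_eq.mp ((exponentVector Γ).map_isConj h)
  rw [exponentVector_gen, exponentVector_gen] at h'
  exact Finsupp.single_left_injective one_ne_zero (Multiplicative.ofAdd.injective h')

open Classical in
variable (Γ) in
/-- The retraction of `A(Γ)` to the parabolic subgroup of `A`, killing the other vertices. -/
noncomputable def retraction (A : Set V) : RAAG Γ →* RAAG Γ :=
  PresentedGroup.toGroup (f := fun v => if v ∈ A then RAAG.gen Γ v else 1) <| by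
    rintro r ⟨v, w, h, rfl⟩
    simp only [map_mul, map_inv, FreeGroup.lift_apply_of]
    have := (gen_commute h).eq
    split_ifs <;> simp [this]

lemma retraction_gen_of_mem {A : Set V} {v : V} (hv : v ∈ A) :
    retraction Γ A (RAAG.gen Γ v) = RAAG.gen Γ v :=
  (PresentedGroup.toGroup.of _).trans (if_pos hv)

lemma retraction_gen_of_notMem {A : Set V} {v : V} (hv : v ∉ A) :
    retraction Γ A (RAAG.gen Γ v) = 1 :=
  (PresentedGroup.toGroup.of _).trans (if_neg hv)

lemma retraction_mem_parabolic (A : Set V) (g : RAAG Γ) : retraction Γ A g ∈ parabolic Γ A := by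
  suffices h : (⊤ : Subgroup (RAAG Γ)) ≤ (parabolic Γ A).comap (retraction Γ A) from
    h (Subgroup.mem_top g)
  rw [← PresentedGroup.closure_range_of, Subgroup.closure_le]
  rintro _ ⟨v, rfl⟩
  change retraction Γ A (RAAG.gen Γ v) ∈ parabolic Γ A
  by_cases hv : v ∈ A
  · exact (retraction_gen_of_mem hv).symm ▸ gen_mem_parabolic hv
  · exact (retraction_gen_of_notMem hv).symm ▸ one_mem _

lemma retraction_eq_self {A : Set V} {g : RAAG Γ} (hg : g ∈ parabolic Γ A) :
    retraction Γ A g = g :=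
  MonoidHom.eqOn_closure (g := MonoidHom.id _)
    (Set.forall_mem_image.mpr fun _ hv => retraction_gen_of_mem hv) hg

lemma mem_of_isConj_gen {A : Set V} {v : V} {g : RAAG Γ} (hg : g ∈ parabolic Γ A)
    (h : IsConj (RAAG.gen Γ v) g) : v ∈ A := by
  by_contra hv
  have hone := (retraction Γ A).map_isConj h
  rw [retraction_gen_of_notMem hv, retraction_eq_self hg, isConj_one_right] at hone
  exact gen_ne_one v (isConj_one_left.mp (hone ▸ h))

end Homomorphisms

section ExtensionGraphVertices

/-- The vertex `v^g` of `Γ^e`. -/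
def ExtVertex.mk (v : V) (g : RAAG Γ) : ExtVertex Γ := ⟨g⁻¹ * RAAG.gen Γ v * g, v, g, rfl⟩

lemma ExtVertex.exists_eq_mk (x : ExtVertex Γ) : ∃ v g, x = mk v g := by
  obtain ⟨_, v, g, rfl⟩ := x
  exact ⟨v, g, rfl⟩

lemma ExtVertex.mk_smul (v : V) (g h : RAAG Γ) : mk v g <• h = mk v (g * h) :=
  Subtype.ext <| show h⁻¹ * (g⁻¹ * RAAG.gen Γ v * g) * h = (g * h)⁻¹ * RAAG.gen Γ v * (g * h) by
    group

lemma ExtVertex.mk_eq_mk_iff {v w : V} {g h : RAAG Γ} :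
    mk v g = mk w h ↔ v = w ∧ g * h⁻¹ ∈ parabolic Γ (closedStar Γ v) := by
  rw [← commute_gen_iff]
  refine Subtype.ext_iff.trans ⟨?_, ?_⟩ <;> simp only [mk]
  · intro heq
    obtain rfl : v = w := eq_of_isConj_gen <| isConj_iff.mpr ⟨h * g⁻¹, calc
      h * g⁻¹ * RAAG.gen Γ v * (h * g⁻¹)⁻¹ = h * (g⁻¹ * RAAG.gen Γ v * g) * h⁻¹ := by group
      _ = RAAG.gen Γ w := by rw [heq]; group⟩
    exact ⟨rfl, mul_inv_eq_iff_eq_mul.mp <| calc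
      g * h⁻¹ * RAAG.gen Γ v * (g * h⁻¹)⁻¹ = g * (h⁻¹ * RAAG.gen Γ v * h) * g⁻¹ := by group
      _ = RAAG.gen Γ v := by rw [← heq]; group⟩
  · rintro ⟨rfl, hc⟩
    calc g⁻¹ * RAAG.gen Γ v * g = h⁻¹ * ((g * h⁻¹)⁻¹ * (RAAG.gen Γ v * (g * h⁻¹))) * h := by group
      _ = h⁻¹ * RAAG.gen Γ v * h := by rw [← hc.eq]; group

lemma exists_mem_parabolic_of_commute_conj {v w : V} {n : RAAG Γ}
    (hc : Commute (n⁻¹ * RAAG.gen Γ v * n) (RAAG.gen Γ w)) :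
    v ∈ closedStar Γ w ∧ ∃ s ∈ parabolic Γ (closedStar Γ w),
      n⁻¹ * RAAG.gen Γ v * n = s⁻¹ * RAAG.gen Γ v * s := by
  have hmem := commute_gen_iff.mp hc
  have hv : v ∈ closedStar Γ w := mem_of_isConj_gen hmem (isConj_iff.mpr ⟨n⁻¹, by rw [inv_inv]⟩)
  refine ⟨hv, retraction Γ (closedStar Γ w) n, retraction_mem_parabolic _ _, ?_⟩
  conv_lhs => rw [← retraction_eq_self hmem]
  simp only [map_mul, map_inv, retraction_gen_of_mem hv]

theorem extensionGraph_adj_iff {x y : ExtVertex Γ} :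
    (extensionGraph Γ).Adj x y ↔
      ∃ v w m, Γ.Adj v w ∧ x = ExtVertex.mk v m ∧ y = ExtVertex.mk w m := by
  constructor
  · rintro ⟨hne, hcomm⟩
    obtain ⟨v, h, rfl⟩ := x.exists_eq_mk
    obtain ⟨w, k, rfl⟩ := y.exists_eq_mk
    have hc : Commute ((h * k⁻¹)⁻¹ * RAAG.gen Γ v * (h * k⁻¹)) (RAAG.gen Γ w) := by
      convert (Commute.conj_iff k).mpr hcomm using 1 <;> simp only [ExtVertex.mk] <;> group
    obtain ⟨hv, s, hs, hvs⟩ := exists_mem_parabolic_of_commute_conj hc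
    have hx : ExtVertex.mk v h = ExtVertex.mk v (s * k) := by
      have hvs' : ExtVertex.mk v (h * k⁻¹) = ExtVertex.mk v s := Subtype.ext hvs
      rw [← ExtVertex.mk_smul, ← hvs', ExtVertex.mk_smul, inv_mul_cancel_right]
    have hy : ExtVertex.mk w k = ExtVertex.mk w (s * k) :=
      (ExtVertex.mk_eq_mk_iff.mpr ⟨rfl, by rwa [mul_inv_cancel_right]⟩).symm
    rcases hv with rfl | hadj
    · exact absurd (hx.trans hy.symm) hne
    · exact ⟨v, w, s * k, hadj.symm, hx, hy⟩
  · rintro ⟨v, w, m, hadj, rfl, rfl⟩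
    refine ⟨fun h => hadj.ne (ExtVertex.mk_eq_mk_iff.mp h).1, ?_⟩
    have hcomm := ((Commute.conj_iff m⁻¹).mpr (gen_commute hadj)).eq
    rwa [inv_inv] at hcomm

end ExtensionGraphVertices

section ClosedStars

lemma notMem_closedStar_iff {u v : V} : u ∉ closedStar Γ v ↔ Γᶜ.Adj v u := by
  rw [closedStar, Set.mem_insert_iff, SimpleGraph.mem_neighborSet, SimpleGraph.compl_adj, not_or,
    ne_comm]

variable (Γ) in
/-- `S` is neither contained in a star of `Γ` nor equal to a join of two sets of vertices; the
latter is encoded as connectedness of the complement graph on `S`. -/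
def IsNonsplit (S : Set V) : Prop :=
  (Γᶜ.induce S).Preconnected ∧ ∀ v, ¬ S ⊆ closedStar Γ v

lemma isNonsplit_univ [Nontrivial V] (hΓ : Γᶜ.Connected) : IsNonsplit Γ Set.univ := by
  refine ⟨((SimpleGraph.induceUnivIso Γᶜ).connected_iff.mpr hΓ).preconnected, fun v h => ?_⟩
  obtain ⟨u, hu⟩ := hΓ.preconnected.exists_adj_of_nontrivial v
  exact notMem_closedStar_iff.mpr hu (h (Set.mem_univ u))

/-- For `v ∈ S` a path from `u` to `v` is cut off just before `v`; from `u = v` one step suffices.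
For `v ∉ S` there are only `|V| - 1` vertices available. -/
lemma IsNonsplit.exists_walk_length_le [Fintype V] (hcard : 3 ≤ Fintype.card V) {S : Set V}
    (hS : IsNonsplit Γ S) (v : V) (u : S) :
    ∃ (w : S) (p : (Γᶜ.induce S).Walk u w),
      w.1 ∉ closedStar Γ v ∧ p.length ≤ Fintype.card V - 2 := by
  classical
  obtain ⟨t, htS, ht⟩ := Set.not_subset.mp (hS.2 v)
  by_cases hvS : v ∈ S
  · by_cases huv : u = ⟨v, hvS⟩
    · subst huv
      have hadj : (Γᶜ.induce S).Adj ⟨v, hvS⟩ ⟨t, htS⟩ := notMem_closedStar_iff.mp ht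
      exact ⟨⟨t, htS⟩, hadj.toWalk, ht, by rw [SimpleGraph.Adj.length_toWalk]; omega⟩
    · obtain ⟨p, hp⟩ := hS.1.exists_isPath u ⟨v, hvS⟩
      have hlen := hp.length_lt.trans_le (Fintype.card_subtype_le _)
      have hadj := p.adj_penultimate (SimpleGraph.Walk.not_nil_of_ne huv)
      refine ⟨p.penultimate, p.dropLast, notMem_closedStar_iff.mpr hadj.symm, ?_⟩
      rw [SimpleGraph.Walk.length_dropLast]
      omega
  · obtain ⟨p, hp⟩ := hS.1.exists_isPath u ⟨t, htS⟩
    have hlen := hp.length_lt.trans_le (Nat.le_sub_one_of_lt (Fintype.card_subtype_lt hvS))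
    exact ⟨_, p, ht, by omega⟩

lemma le_add_length_of_forall_adj {P : Type*} {H : SimpleGraph P} {f : P → ℕ}
    (hf : ∀ ⦃x y⦄, H.Adj x y → f x ≤ f y + 1) {x y : P} (p : H.Walk x y) :
    f x ≤ f y + p.length := by
  induction p with
  | nil => exact le_rfl
  | cons h p ih =>
    have := hf h
    rw [SimpleGraph.Walk.length_cons]
    omega

lemma IsNonsplit.le_add_card_sub_two [Fintype V] (hcard : 3 ≤ Fintype.card V) {S : Set V}
    (hS : IsNonsplit Γ S) {f : V → ℕ}
    (hf : ∀ u ∈ S, ∀ w ∈ S, Γᶜ.Adj u w → f u ≤ f w + 1) {v : V} {j : ℕ}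
    (hj : ∀ u ∈ S, u ∉ closedStar Γ v → f u ≤ j) {u : V} (hu : u ∈ S) :
    f u ≤ j + (Fintype.card V - 2) := by
  obtain ⟨w, p, hw, hp⟩ := hS.exists_walk_length_le hcard v ⟨u, hu⟩
  calc f u ≤ f w + p.length :=
        le_add_length_of_forall_adj (f := fun x : S => f x)
          (fun x y hxy => hf x x.2 y y.2 hxy) p
    _ ≤ j + (Fintype.card V - 2) := add_le_add (hj w w.2 hw) hp

end ClosedStars

section Levels

/-- The set of vertices occurring in a word. -/
def support (W : List (V × Bool)) : Set V := {u | u ∈ W.map Prod.fst}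

lemma exists_eq_append_of_isSuffix_flatten_replicate {α : Type*} {W D : List α} {n : ℕ}
    (h : D <:+ (List.replicate n W).flatten) :
    ∃ P k, P <:+ W ∧ D = P ++ (List.replicate k W).flatten := by
  induction n with
  | zero => exact ⟨[], 0, List.nil_suffix, by simpa using h⟩
  | succ n ih =>
    obtain ⟨T, hT⟩ := h
    rw [List.replicate_succ, List.flatten_cons] at hT
    rcases List.append_eq_append_iff.mp hT with ⟨A, hA, rfl⟩ | ⟨A, rfl, hA⟩
    · exact ⟨A, n, ⟨T, hA.symm⟩, rfl⟩
    · exact ih ⟨A, hA.symm⟩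

variable [DecidableEq V]

lemma vertexCount_flatten_replicate (u : V) (W : List (V × Bool)) (n : ℕ) :
    vertexCount u (List.replicate n W).flatten = n * vertexCount u W := by
  induction n with
  | zero => simp [vertexCount]
  | succ n ih =>
    rw [List.replicate_succ, List.flatten_cons, vertexCount_append, ih, Nat.succ_mul, add_comm]

/-- The number of copies of `W`, the last one possibly incomplete, needed to reach the count `c u`
of the vertex `u`. -/
def level (W : List (V × Bool)) (c : V → ℕ) (u : V) : ℕ := c u ⌈/⌉ vertexCount u W

lemma level_le_iff {W : List (V × Bool)} {c : V → ℕ} {u : V} (hu : u ∈ support W) {k : ℕ} :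
    level W c u ≤ k ↔ c u ≤ vertexCount u W * k :=
  ceilDiv_le_iff_le_mul (vertexCount_pos.mpr hu)

lemma level_of_eq_mul {W : List (V × Bool)} {c : V → ℕ} {u : V} (hu : u ∈ support W) {n : ℕ}
    (hc : c u = n * vertexCount u W) : level W c u = n := by
  rw [level, hc, mul_comm]
  exact smul_ceilDiv (vertexCount_pos.mpr hu) n

lemma le_level_of_mul_le {W : List (V × Bool)} {c : V → ℕ} {u : V} (hu : u ∈ support W) {k : ℕ}
    (hc : vertexCount u W * k ≤ c u) : k ≤ level W c u :=
  Nat.le_of_mul_le_mul_left (hc.trans ((level_le_iff hu).mp le_rfl)) (vertexCount_pos.mpr hu)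

lemma IsValidState.level_le_level_add_one {W : List (V × Bool)} {n : ℕ} {c : V → ℕ}
    (hc : IsValidState Γ (List.replicate n W).flatten c) {u w : V} (hu : u ∈ support W)
    (hw : w ∈ support W) (huw : Γᶜ.Adj u w) : level W c u ≤ level W c w + 1 := by
  obtain ⟨D, hD, hcu, hcw⟩ := (hc u).2 w huw.1.symm huw.2
  obtain ⟨P, k, hP, rfl⟩ := exists_eq_append_of_isSuffix_flatten_replicate hD
  rw [vertexCount_append, vertexCount_flatten_replicate] at hcu hcw
  calc level W c u ≤ k + 1 := (level_le_iff hu).mpr <| by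
        rw [← hcu, mul_add_one, mul_comm, add_comm]
        exact Nat.add_le_add_left (vertexCount_le_of_isSuffix hP u) _
    _ ≤ level W c w + 1 := Nat.add_le_add_right (le_level_of_mul_le hw <| by
        rw [← hcw, mul_comm]; exact Nat.le_add_left _ _) 1

lemma wordRep_apply_eq_of_mk_eq {L : List (V × Bool)} {v u : V} {g h : RAAG Γ}
    (hgh : ExtVertex.mk v g = ExtVertex.mk v h) (hu : u ∉ closedStar Γ v) (c : V → ℕ) :
    wordRep Γ L g c u = wordRep Γ L h c u := by
  conv_lhs => rw [← inv_mul_cancel_right g h, map_mul, Equiv.Perm.mul_apply]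
  exact wordRep_apply_of_mem_parabolic hu (ExtVertex.mk_eq_mk_iff.mp hgh).2 _

/-- The vertex `x = v ^ h` of `Γ^e` has, with respect to the `n`-th power of the word `W`, level at
most `j` at all vertices of `W` off the star of `v`. This does not depend on the choice of `h`, see
`levelLE_mk_iff`. -/
def LevelLE (W : List (V × Bool)) (n : ℕ) (x : ExtVertex Γ) (j : ℕ) : Prop :=
  ∀ v h, x = ExtVertex.mk v h → ∀ u ∈ support W, u ∉ closedStar Γ v →
    level W (wordRep Γ (List.replicate n W).flatten h 0) u ≤ j

lemma levelLE_mk_iff {W : List (V × Bool)} {n : ℕ} {v : V} {h : RAAG Γ} {j : ℕ} :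
    LevelLE W n (ExtVertex.mk v h) j ↔ ∀ u ∈ support W, u ∉ closedStar Γ v →
      level W (wordRep Γ (List.replicate n W).flatten h 0) u ≤ j := by
  refine ⟨fun H => H v h rfl, fun H w k hwk u hu huw => ?_⟩
  obtain rfl := (ExtVertex.mk_eq_mk_iff.mp hwk).1
  rw [level, ← wordRep_apply_eq_of_mk_eq hwk huw]
  exact H u hu huw

variable [Fintype V] {W : List (V × Bool)} {n : ℕ}

lemma LevelLE.of_adj (hcard : 3 ≤ Fintype.card V)
    (hW : IsReducedWord Γ (List.replicate n W).flatten) (hsupp : IsNonsplit Γ (support W))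
    {x y : ExtVertex Γ} {j : ℕ} (hx : LevelLE W n x j) (hxy : (extensionGraph Γ).Adj x y) :
    LevelLE W n y (j + (Fintype.card V - 2)) := by
  obtain ⟨v, w, m, -, rfl, rfl⟩ := extensionGraph_adj_iff.mp hxy
  exact levelLE_mk_iff.mpr fun u hu _ => hsupp.le_add_card_sub_two hcard
    (fun a ha b hb hab => (isValidState_wordRep hW m).level_le_level_add_one ha hb hab)
    (levelLE_mk_iff.mp hx) hu

lemma LevelLE.of_walk (hcard : 3 ≤ Fintype.card V)
    (hW : IsReducedWord Γ (List.replicate n W).flatten) (hsupp : IsNonsplit Γ (support W))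
    {x y : ExtVertex Γ} (p : (extensionGraph Γ).Walk x y) {j : ℕ} (hx : LevelLE W n x j) :
    LevelLE W n y (j + p.length * (Fintype.card V - 2)) := by
  induction p generalizing j with
  | nil => simpa using hx
  | cons h p ih =>
    rw [SimpleGraph.Walk.length_cons, Nat.succ_mul, add_comm (_ * _), ← add_assoc]
    exact ih (hx.of_adj hcard hW hsupp h)

end Levels

section TranslationLength

lemma dist_hom_le {P Q : Type*} {X : SimpleGraph P} {Y : SimpleGraph Q} (f : X →g Y) {x y : P}
    (h : X.Reachable x y) : Y.dist (f x) (f y) ≤ X.dist x y := by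
  obtain ⟨p, hp⟩ := h.exists_walk_length_eq_dist
  rw [← hp, ← p.length_map f]
  exact SimpleGraph.dist_le _

lemma dist_iso {P Q : Type*} {X : SimpleGraph P} {Y : SimpleGraph Q} (f : X ≃g Y) (x y : P) :
    Y.dist (f x) (f y) = X.dist x y := by
  by_cases h : X.Reachable x y
  · refine (dist_hom_le f.toHom h).antisymm ?_
    simpa using dist_hom_le f.symm.toHom (f.reachable_iff.mpr h)
  · rw [SimpleGraph.dist_eq_zero_of_not_reachable h,
      SimpleGraph.dist_eq_zero_of_not_reachable (mt f.reachable_iff.mp h)]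

variable {G P : Type*} [Group G] [MulAction Gᵐᵒᵖ P] {X : SimpleGraph P}

variable (G X) in
/-- The right action of `G` on the vertices of `X` is by graph automorphisms. -/
def ActsByAutomorphisms : Prop := ∀ (g : G) (x y : P), X.Adj (x <• g) (y <• g) ↔ X.Adj x y

lemma ActsByAutomorphisms.dist_smul_smul (hX : ActsByAutomorphisms G X) (g : G) (x y : P) :
    X.dist (x <• g) (y <• g) = X.dist x y :=
  dist_iso (X := X) (Y := X) ⟨MulAction.toPerm (MulOpposite.op g), hX g _ _⟩ x y

lemma ActsByAutomorphisms.dist_smul_self_le (hX : ActsByAutomorphisms G X) (hc : X.Connected)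
    (g : G) (x y : P) : X.dist (y <• g) y ≤ X.dist (x <• g) x + 2 * X.dist x y := by
  calc X.dist (y <• g) y ≤ X.dist (y <• g) (x <• g) + X.dist (x <• g) y := hc.dist_triangle
    _ ≤ X.dist (y <• g) (x <• g) + (X.dist (x <• g) x + X.dist x y) :=
        Nat.add_le_add_left hc.dist_triangle _
    _ = X.dist (x <• g) x + 2 * X.dist x y := by
        rw [hX.dist_smul_smul, SimpleGraph.dist_comm (u := y)]; ring

lemma ActsByAutomorphisms.isTranslationLength_of_tendsto (hX : ActsByAutomorphisms G X)
    (hc : X.Connected) {g : G} {x : P} {t : ℝ}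
    (ht : Filter.Tendsto (fun n : ℕ => (X.dist (x <• g ^ n) x : ℝ) / n) Filter.atTop (𝓝 t)) :
    IsTranslationLength X g t := by
  intro y
  refine tendsto_of_tendsto_of_dist ht (squeeze_zero (fun _ => dist_nonneg) (fun n => ?_)
    (tendsto_const_div_atTop_nhds_zero_nat (2 * X.dist x y : ℝ)))
  have hxy : (X.dist (x <• g ^ n) x : ℝ) ≤ X.dist (y <• g ^ n) y + 2 * X.dist x y := by
    rw [SimpleGraph.dist_comm (u := x) (v := y)]
    exact_mod_cast hX.dist_smul_self_le hc (g ^ n) y x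
  have hyx : (X.dist (y <• g ^ n) y : ℝ) ≤ X.dist (x <• g ^ n) x + 2 * X.dist x y :=
    mod_cast hX.dist_smul_self_le hc (g ^ n) x y
  rw [Real.dist_eq, ← sub_div, abs_div, Nat.abs_cast]
  gcongr
  exact abs_sub_le_iff.mpr ⟨by linarith, by linarith⟩

lemma ActsByAutomorphisms.subadditive_dist (hX : ActsByAutomorphisms G X) (hc : X.Connected)
    (g : G) (x : P) : Subadditive fun n : ℕ => (X.dist (x <• g ^ n) x : ℝ) := by
  intro m n
  have htri : X.dist (x <• g ^ (m + n)) x ≤ X.dist (x <• g ^ (m + n)) (x <• g ^ n) +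
      X.dist (x <• g ^ n) x := hc.dist_triangle
  rw [pow_add, MulOpposite.op_mul, mul_smul, hX.dist_smul_smul] at htri
  beta_reduce
  rw [pow_add, MulOpposite.op_mul, mul_smul]
  exact_mod_cast htri

theorem ActsByAutomorphisms.existsUnique_isTranslationLength (hX : ActsByAutomorphisms G X)
    (hc : X.Connected) (g : G) : ∃! t, IsTranslationLength X g t := by
  obtain ⟨x⟩ := hc.nonempty
  have hlim := (hX.subadditive_dist hc g x).tendsto_lim
    ⟨0, by rintro _ ⟨n, rfl⟩; positivity⟩
  have ht := hX.isTranslationLength_of_tendsto hc hlim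
  exact ⟨_, ht, fun s hs => tendsto_nhds_unique (hs x) (ht x)⟩

lemma IsTranslationLength.of_isConj (hX : ActsByAutomorphisms G X) {g h : G} {t : ℝ}
    (ht : IsTranslationLength X g t) (hgh : IsConj g h) : IsTranslationLength X h t := by
  obtain ⟨k, rfl⟩ := isConj_iff.mp hgh
  intro x
  refine (ht (x <• k)).congr fun n => ?_
  rw [conj_pow, ← hX.dist_smul_smul k⁻¹]
  simp only [← mul_smul, ← MulOpposite.op_mul, mul_inv_cancel, MulOpposite.op_one, one_smul,
    mul_assoc]

lemma IsTranslationLength.nonpos_of_dist_le {g : G} {t : ℝ} (ht : IsTranslationLength X g t)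
    {x : P} {B : ℕ} (hB : ∀ n, X.dist (x <• g ^ n) x ≤ B) : t ≤ 0 := by
  refine le_of_tendsto_of_tendsto' (ht x) (tendsto_const_div_atTop_nhds_zero_nat (B : ℝ))
    fun n => ?_
  gcongr
  exact hB n

lemma IsTranslationLength.one_div_le {g : G} {t : ℝ} (ht : IsTranslationLength X g t) {x : P}
    {c : ℕ} (hc : 0 < c) (hx : ∀ n, n ≤ X.dist (x <• g ^ n) x * c) : 1 / (c : ℝ) ≤ t := by
  refine ge_of_tendsto (ht x) ?_
  filter_upwards [Filter.eventually_gt_atTop 0] with n hn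
  rw [div_le_div_iff₀ (mod_cast hc) (mod_cast hn), one_mul]
  exact_mod_cast hx n

end TranslationLength

section ActionOnExtensionGraph

lemma actsByAutomorphisms_extensionGraph :
    ActsByAutomorphisms (RAAG Γ) (extensionGraph Γ) := by
  intro g x y
  refine and_congr (MulAction.injective (MulOpposite.op g)).ne_iff ?_
  have hconj := Commute.conj_iff (a := x.1) (b := y.1) g⁻¹
  rwa [inv_inv] at hconj

lemma reachable_mk_mk (hΓ : Γ.Preconnected) (v w : V) (g : RAAG Γ) :
    (extensionGraph Γ).Reachable (ExtVertex.mk v g) (ExtVertex.mk w g) :=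
  (hΓ v w).map (G' := extensionGraph Γ)
    ⟨(ExtVertex.mk · g), fun h => extensionGraph_adj_iff.mpr ⟨_, _, g, h, rfl, rfl⟩⟩

lemma ExtVertex.mk_letter_mul (l : V × Bool) (g : RAAG Γ) :
    mk l.1 (letter Γ l * g) = mk l.1 g :=
  mk_eq_mk_iff.mpr ⟨rfl, by
    rw [mul_inv_cancel_right]
    exact letter_mem_parabolic (Set.mem_insert _ _)⟩

theorem extensionGraph_connected (hΓ : Γ.Connected) : (extensionGraph Γ).Connected := by
  obtain ⟨v⟩ := hΓ.nonempty
  have hword (W : List (V × Bool)) (u : V) :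
      (extensionGraph Γ).Reachable (ExtVertex.mk u (wordProd Γ W)) (ExtVertex.mk v 1) := by
    induction W generalizing u with
    | nil => exact wordProd_nil (Γ := Γ) ▸ reachable_mk_mk hΓ.preconnected u v 1
    | cons l W ih =>
      have hstep := reachable_mk_mk hΓ.preconnected u l.1 (letter Γ l * wordProd Γ W)
      rw [ExtVertex.mk_letter_mul, ← wordProd_cons] at hstep
      exact hstep.trans (ih l.1)
  refine (SimpleGraph.connected_iff_exists_forall_reachable _).mpr ⟨ExtVertex.mk v 1, fun x => ?_⟩
  obtain ⟨u, g, rfl⟩ := x.exists_eq_mk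
  obtain ⟨W, rfl⟩ := wordProd_surjective g
  exact (hword W u).symm

end ActionOnExtensionGraph

section BoundedOrbits

lemma mk_one_smul_of_mem_parabolic {v : V} {g : RAAG Γ} (hg : g ∈ parabolic Γ (closedStar Γ v)) :
    ExtVertex.mk (Γ := Γ) v 1 <• g = ExtVertex.mk v 1 := by
  rw [ExtVertex.mk_smul, one_mul]
  exact ExtVertex.mk_eq_mk_iff.mpr ⟨rfl, by rwa [inv_one, mul_one]⟩

lemma parabolic_union_le_normalizer {A B : Set V} (hAB : ∀ a ∈ A, ∀ b ∈ B, Γ.Adj a b) :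
    parabolic Γ (A ∪ B) ≤ Subgroup.normalizer (parabolic Γ B) := by
  rw [parabolic, Set.image_union, Subgroup.closure_union]
  refine sup_le (le_trans (fun a ha => ?_) (Subgroup.centralizer_le_normalizer _))
    Subgroup.le_normalizer
  exact Subgroup.mem_centralizer_iff.mpr fun b hb =>
    (commute_of_mem_parabolic (fun a ha b hb => gen_commute (hAB a ha b hb)) ha hb).eq.symm

lemma dist_mk_smul_le_two_of_join {A B : Set V} (hAB : ∀ a ∈ A, ∀ b ∈ B, Γ.Adj a b) {a b : V}
    (ha : a ∈ A) (hb : b ∈ B) {g : RAAG Γ} (hg : g ∈ parabolic Γ (A ∪ B)) :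
    (extensionGraph Γ).dist (ExtVertex.mk b 1 <• g) (ExtVertex.mk b 1) ≤ 2 := by
  have hadj {h : RAAG Γ} (hh : h ∈ parabolic Γ (A ∪ B)) :
      (extensionGraph Γ).Adj (ExtVertex.mk b h) (ExtVertex.mk a 1) := by
    have hmem : h⁻¹ * RAAG.gen Γ b * h ∈ parabolic Γ B := by
      have := (Subgroup.mem_normalizer_iff.mp
        (parabolic_union_le_normalizer hAB (inv_mem hh)) _).mp (gen_mem_parabolic hb)
      rwa [inv_inv] at this
    refine ⟨fun heq => (hAB a ha b hb).ne (ExtVertex.mk_eq_mk_iff.mp heq).1.symm, ?_⟩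
    simpa [ExtVertex.mk] using (commute_of_mem_parabolic
      (fun a ha b hb => gen_commute (hAB a ha b hb)) (gen_mem_parabolic ha) hmem).eq.symm
  rw [ExtVertex.mk_smul, one_mul]
  exact SimpleGraph.dist_le (.cons (hadj hg) (.cons (hadj (one_mem _)).symm .nil))

lemma exists_join_of_not_preconnected_induce_compl {S : Set V}
    (hS : ¬ (Γᶜ.induce S).Preconnected) :
    ∃ A B : Set V, A.Nonempty ∧ B.Nonempty ∧ S = A ∪ B ∧ ∀ a ∈ A, ∀ b ∈ B, Γ.Adj a b := by
  obtain ⟨u, w, huw⟩ : ∃ u w, ¬ (Γᶜ.induce S).Reachable u w := by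
    simpa only [SimpleGraph.Preconnected, not_forall] using hS
  let C : Set S := {x | (Γᶜ.induce S).Reachable u x}
  refine ⟨Subtype.val '' C, Subtype.val '' Cᶜ, ⟨u, u, .refl u, rfl⟩, ⟨w, w, huw, rfl⟩, ?_, ?_⟩
  · rw [← Set.image_union, Set.union_compl_self, Set.image_univ, Subtype.range_coe]
  · rintro _ ⟨a, ha, rfl⟩ _ ⟨b, hb, rfl⟩
    by_contra hab
    have hne : a ≠ b := ne_of_mem_of_not_mem ha hb
    have hadj : (Γᶜ.induce S).Adj a b := ⟨Subtype.coe_ne_coe.mpr hne, hab⟩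
    exact hb (SimpleGraph.Reachable.trans ha hadj.reachable)

lemma exists_dist_mk_smul_le_two {S : Set V} (hS : ¬ IsNonsplit Γ S) :
    ∃ v, ∀ g ∈ parabolic Γ S,
      (extensionGraph Γ).dist (ExtVertex.mk v 1 <• g) (ExtVertex.mk v 1) ≤ 2 := by
  rcases not_and_or.mp hS with hsplit | hstar
  · obtain ⟨A, B, ⟨a, ha⟩, ⟨b, hb⟩, rfl, hAB⟩ :=
      exists_join_of_not_preconnected_induce_compl hsplit
    exact ⟨b, fun g hg => dist_mk_smul_le_two_of_join hAB ha hb hg⟩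
  · obtain ⟨v, hv⟩ := not_forall_not.mp hstar
    refine ⟨v, fun g hg => ?_⟩
    have hg' := Subgroup.closure_mono (Set.image_mono hv) hg
    rw [mk_one_smul_of_mem_parabolic hg', SimpleGraph.dist_self]
    exact Nat.zero_le 2

end BoundedOrbits

section LowerBound

variable [Fintype V]

theorem le_dist_mul_card_sub_two (hcard : 3 ≤ Fintype.card V)
    (hconn : (extensionGraph Γ).Connected) {W : List (V × Bool)} {n : ℕ}
    (hW : IsReducedWord Γ (List.replicate n W).flatten) (hsupp : IsNonsplit Γ (support W))
    (v : V) :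
    n ≤ (extensionGraph Γ).dist (ExtVertex.mk v 1 <• wordProd Γ W ^ n) (ExtVertex.mk v 1) *
      (Fintype.card V - 2) := by
  classical
  obtain ⟨p, hp⟩ := hconn.exists_walk_length_eq_dist (ExtVertex.mk v 1)
    (ExtVertex.mk (Γ := Γ) v 1 <• wordProd Γ W ^ n)
  rw [SimpleGraph.dist_comm, ← hp]
  have hzero : LevelLE W n (ExtVertex.mk (Γ := Γ) v 1) 0 := levelLE_mk_iff.mpr fun u hu _ =>
    (level_of_eq_mul hu (by simp)).le
  obtain ⟨u, hu, huv⟩ := Set.not_subset.mp (hsupp.2 v)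
  calc n = level W (wordRep Γ (List.replicate n W).flatten (wordProd Γ W ^ n) 0) u := by
        rw [← wordProd_flatten_replicate, wordRep_isSuffix hW List.suffix_rfl]
        exact (level_of_eq_mul hu (vertexCount_flatten_replicate u W n)).symm
    _ ≤ 0 + p.length * (Fintype.card V - 2) := hzero.of_walk hcard hW hsupp p v _
        (by rw [ExtVertex.mk_smul, one_mul]) u hu huv
    _ = p.length * (Fintype.card V - 2) := zero_add _

lemma one_div_le_of_isNonsplit_support (hcard : 3 ≤ Fintype.card V)
    (hconn : (extensionGraph Γ).Connected) {W : List (V × Bool)} (hW : IsReducedWord Γ (W ++ W))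
    (hsupp : IsNonsplit Γ (support W)) {t : ℝ}
    (ht : IsTranslationLength (extensionGraph Γ) (wordProd Γ W) t) :
    1 / ((Fintype.card V : ℝ) - 2) ≤ t := by
  classical
  obtain ⟨v⟩ : Nonempty V := Fintype.card_pos_iff.mp (by omega)
  have hcast : ((Fintype.card V - 2 : ℕ) : ℝ) = (Fintype.card V : ℝ) - 2 :=
    Nat.cast_sub (by omega)
  rw [← hcast]
  exact ht.one_div_le (by omega) fun n =>
    le_dist_mul_card_sub_two hcard hconn (isReducedWord_flatten_replicate hW n) hsupp v

theorem one_div_le_of_pos (hcard : 3 ≤ Fintype.card V) (hconn : (extensionGraph Γ).Connected)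
    {g : RAAG Γ} {t : ℝ} (ht : IsTranslationLength (extensionGraph Γ) g t) (hpos : 0 < t) :
    1 / ((Fintype.card V : ℝ) - 2) ≤ t := by
  obtain ⟨W, hgW, hW⟩ := exists_isConj_wordProd_isReducedWord g
  have htW := ht.of_isConj actsByAutomorphisms_extensionGraph hgW
  refine one_div_le_of_isNonsplit_support hcard hconn hW ?_ htW
  by_contra hsplit
  obtain ⟨v, hv⟩ := exists_dist_mk_smul_le_two hsplit
  have hmem : wordProd Γ W ∈ parabolic Γ (support W) :=
    wordProd_mem_parabolic fun l hl => List.mem_map_of_mem hl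
  exact hpos.not_ge (htW.nonpos_of_dist_le fun n => hv _ (pow_mem hmem n))

theorem exists_pos_isTranslationLength (hcard : 3 ≤ Fintype.card V)
    (hconn : (extensionGraph Γ).Connected) (hcompl : Γᶜ.Connected) :
    ∃ (g : RAAG Γ) (t : ℝ), 0 < t ∧ IsTranslationLength (extensionGraph Γ) g t := by
  have : Nontrivial V := Fintype.one_lt_card_iff_nontrivial.mp (by omega)
  let W : List (V × Bool) := Finset.univ.toList.map fun v => (v, true)
  have hW : IsReducedWord Γ (W ++ W) := isReducedWord_of_forall_snd <| by simp [W]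
  have hsupp : support W = Set.univ := Set.eq_univ_of_forall fun v => by simp [support, W]
  obtain ⟨t, ht, -⟩ := actsByAutomorphisms_extensionGraph.existsUnique_isTranslationLength hconn
    (wordProd Γ W)
  have hle := one_div_le_of_isNonsplit_support hcard hconn hW (hsupp ▸ isNonsplit_univ hcompl) ht
  have hcard' : (3 : ℝ) ≤ Fintype.card V := mod_cast hcard
  exact ⟨_, t, (one_div_pos.mpr (by linarith)).trans_le hle, ht⟩

end LowerBound

end ExtensionGraph

theorem theoremB {V : Type*} [Fintype V] (Γ : SimpleGraph V)
    (hcard : 4 ≤ Fintype.card V) (hconn : Γ.Connected) (hcompl : Γᶜ.Connected) :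
    (ExtensionGraph.extensionGraph Γ).Connected ∧
    (∀ g : ExtensionGraph.RAAG Γ,
      ∃! t : ℝ, ExtensionGraph.IsTranslationLength (ExtensionGraph.extensionGraph Γ) g t) ∧
    (ExtensionGraph.loxodromicLengths (ExtensionGraph.extensionGraph Γ)
      (⊤ : Subgroup (ExtensionGraph.RAAG Γ))).Nonempty ∧
    1 / ((Fintype.card V : ℝ) - 2) ≤
      ExtensionGraph.minTranslationLength (ExtensionGraph.extensionGraph Γ)
        (⊤ : Subgroup (ExtensionGraph.RAAG Γ)) := by
  have hcard3 : 3 ≤ Fintype.card V := by omega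
  have hext := ExtensionGraph.extensionGraph_connected hconn
  have hlox : (ExtensionGraph.loxodromicLengths (ExtensionGraph.extensionGraph Γ)
      (⊤ : Subgroup (ExtensionGraph.RAAG Γ))).Nonempty := by
    obtain ⟨g, t, hpos, ht⟩ := ExtensionGraph.exists_pos_isTranslationLength hcard3 hext hcompl
    exact ⟨t, hpos, g, Subgroup.mem_top g, ht⟩
  refine ⟨hext, ExtensionGraph.actsByAutomorphisms_extensionGraph.existsUnique_isTranslationLength
    hext, hlox, le_csInf hlox ?_⟩
  rintro t ⟨hpos, g, -, ht⟩
  exact ExtensionGraph.one_div_le_of_pos hcard3 hext ht hpos
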